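/- **Setting.** Let $n\ge 1$, $\sigma_x=\begin{pmatrix}0&1\\1&0\end{pmatrix}$, $\sigma_y=\begin{pmatrix}0&-i\\i&0\end{pmatrix}$ and $R_y(\theta)=\begin{pmatrix}\cos\frac\theta2&-\sin\frac\theta2\\ \sin\frac\theta2&\cos\frac\theta2\end{pmatrix}$. An *almost-commuting circuit* on $n$ data qubits is a finite sequence of layers, each of which is either a real $Y$-diagonal unitary (a unitary with real entries in the computational basis that is diagonal in the product eigenbasis of $\sigma_y$) acting on a subset $S$ of the data qubits, or the gate $R_z(\frac{j\pi}{2})=\mathrm{diag}(1,e^{ij\pi/2})$ with $j\in\{1,3\}$ on the first data qubit. **Scheme.** Alice holds the $n$ data qubits and one additional *phase qubit*. For each layer with a $Y$-diagonal unitary on $S$ and each $k\in S$ (a *gate gadget*), Alice and Bob share a fresh EPR pair $\frac1{\sqrt2}(|00\rangle+|11\rangle)$. Alice goes through the layers in order. For a layer $R_z(\frac{j\pi}2)$ she applies the controlled-$R_y(j\pi)$ gate with the first data qubit as the control and the phase qubit as the target. For a $Y$-diagonal layer on $S$ she does the following for every $k\in S$: she applies the controlled-$i\sigma_y$ gate with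 her half of the EPR pair of this gadget as the control and the $k$-th data qubit as the target, then $R_y(\frac\pi2)$ on her half of the EPR pair, and then she measures that qubit in the $Z$ basis. She sends all measurement outcomes to Bob. (Afterwards Bob acts only on what he holds, and his only message to Alice comes at the end.) The *ciphertext* is the joint state at the moment when Bob has received all outcomes; Bob's part of it consists of his halves of the EPR pairs and the received outcomes. **Allowed inputs.** The allowed pure input states of the data qubits and the phase qubit are (a) the product states $|v_1\rangle\otimes\cdots\otimes|v_n\rangle$ of real unit vectors $v_k\in\mathbb R^2$ on the data qubits, with the phase qubit in the state $|0\rangle$; and (b) the states in which the first data qubit and the phase qubit are in the rebit form $$a|0\rangle|0\rangle+b|0\rangle|1\rangle+c|1\rangle|0\rangle+d|1\rangle|1\rangle\qquad(a,b,c,d\in\mathbb R,\ a^2+b^2+c^2+d^2=1)$$ of an arbitrary one-qubit state $(a+bi)|0\rangle+(c+di)|1\rangle$, and the other data qubits are in a product of real one-qubit states $|v_2\rangle\otimes\cdots\otimes|v_n\rangle$. The allowed input states are these pure states and their probabilistic mixtures. **Theorem.** For every $n\ge1$ and every almost-commuting circuit on $n$ data qubits, the input data is perfectly secure in this scheme: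 Bob's reduced density operator of the ciphertext (on his halves of the EPR pairs together with the received measurement outcomes) is the same for all allowed input states, of both types. -/

import Mathlib

namespace QHE

noncomputable section

/-! ### One-qubit gates and gates embedded in a register of qubits -/

/-- The Pauli matrix `σ_x`. -/
def sigmaX : Matrix (Fin 2) (Fin 2) ℂ := !![0, 1; 1, 0]

/-- The Pauli matrix `σ_y`. -/
def sigmaY : Matrix (Fin 2) (Fin 2) ℂ := !![0, -Complex.I; Complex.I, 0]

/-- The rotation `R_y(θ)`. -/
def Ry (θ : ℝ) : Matrix (Fin 2) (Fin 2) ℂ :=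
  !![(Real.cos (θ / 2) : ℂ), -(Real.sin (θ / 2) : ℂ);
     (Real.sin (θ / 2) : ℂ), (Real.cos (θ / 2) : ℂ)]

/-- The projector `|r⟩⟨r|` of one qubit. -/
def proj (r : Fin 2) : Matrix (Fin 2) (Fin 2) ℂ := Matrix.single r r 1

/-- Operators on a register whose qubits are labelled by `Q`, as matrices in the computational
basis (whose elements are the bit assignments `Q → Fin 2`). -/
abbrev Op (Q : Type) : Type := Matrix (Q → Fin 2) (Q → Fin 2) ℂ

/-- The one-qubit operator `M` on the qubit `q`, the identity on all the others. -/
def onQubit {Q : Type} [Fintype Q] [DecidableEq Q] (q : Q) (M : Matrix (Fin 2) (Fin 2) ℂ) :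
    Op Q :=
  Matrix.of fun x y => if ∀ p, p ≠ q → x p = y p then M (x q) (y q) else 0

/-- The controlled-`M` gate with control qubit `ctl` and target qubit `tgt` (`ctl ≠ tgt`). -/
def controlled {Q : Type} [Fintype Q] [DecidableEq Q] (ctl tgt : Q)
    (M : Matrix (Fin 2) (Fin 2) ℂ) : Op Q :=
  onQubit ctl (proj 0) + onQubit ctl (proj 1) * onQubit tgt M

/-- The action `ρ ↦ G ρ G†` of an operator `G` on density operators. -/
def applyOp {Q : Type} [Fintype Q] [DecidableEq Q] (G ρ : Op Q) : Op Q :=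
  G * ρ * G.conjTranspose

/-! ### Almost-commuting circuits (logical level) -/

/-- The eigenvectors `(|0⟩ + i|1⟩)/√2` (for `s = 0`) and `(|0⟩ - i|1⟩)/√2` (for `s = 1`) of
`σ_y`. -/
def yVec (s : Fin 2) : Fin 2 → ℂ :=
  ![1 / (Real.sqrt 2 : ℂ), (if s = 0 then Complex.I else -Complex.I) / (Real.sqrt 2 : ℂ)]

/-- The product `Y` basis of a register of qubits. -/
def yBasis {κ : Type} [Fintype κ] (s : κ → Fin 2) : (κ → Fin 2) → ℂ :=
  fun x => ∏ k, yVec (s k) (x k)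

/-- Real `Y`-diagonal unitaries: unitary, with real entries in the computational basis, and
diagonal in the product `Y` basis. -/
structure IsRealYDiagonalUnitary {κ : Type} [Fintype κ] [DecidableEq κ] (U : Op κ) : Prop where
  unitary : U ∈ Matrix.unitaryGroup (κ → Fin 2) ℂ
  real : ∀ x y, (U x y).im = 0
  diagonal : ∀ s : κ → Fin 2, ∃ c : ℂ, U.mulVec (yBasis s) = c • yBasis s

/-- The layers of an almost-commuting logical circuit on `n` data qubits: a real `Y`-diagonal
unitary on a subset `S` of the data qubits, or `R_z(jπ/2)`, `j ∈ {1, 3}`, on the first one. -/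
inductive Layer (n : ℕ) : Type
  | ydiag (S : Finset (Fin n)) (U : Op {k // k ∈ S}) (hU : IsRealYDiagonalUnitary U) : Layer n
  | rz (j : ℕ) (hj : j = 1 ∨ j = 3) : Layer n

/-- An almost-commuting circuit, as the list of its layers, in the order of application. -/
abbrev AlmostCommutingCircuit (n : ℕ) : Type := List (Layer n)

/-- The data qubits of a layer that need a gate gadget. -/
def Layer.support {n : ℕ} : Layer n → Finset (Fin n)
  | .ydiag S _ _ => S
  | .rz _ _ => ∅

/-- The gate gadgets of a circuit: one for each layer and each data qubit on which the
`Y`-diagonal unitary of that layer acts. -/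
abbrev Gadget {n : ℕ} (c : AlmostCommutingCircuit n) : Type :=
  Σ l : Fin c.length, {k : Fin n // k ∈ (c.get l).support}

/-! ### The registers of the two parties -/

/-- Alice's input qubits: the data qubits and the phase qubit. -/
abbrev InputQubit (n : ℕ) : Type := Fin n ⊕ Unit

/-- Alice's qubits: the input qubits and her halves of the EPR pairs, one for each `e : E`. -/
abbrev AliceQubit (n : ℕ) (E : Type) : Type := InputQubit n ⊕ E

/-- Bob's qubits: his halves of the EPR pairs, and for each of them a bit (kept as a qubit in a
computational basis state) for the message that he receives from Alice. -/
abbrev BobQubit (E : Type) : Type := E ⊕ E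

/-- All the qubits. -/
abbrev Qubit (n : ℕ) (E : Type) : Type := AliceQubit n E ⊕ BobQubit E

/-- The `k`-th data qubit. -/
def qData {n : ℕ} (E : Type) (k : Fin n) : Qubit n E := .inl (.inl (.inl k))

/-- The phase qubit. -/
def qPhase (n : ℕ) (E : Type) : Qubit n E := .inl (.inl (.inr ()))

/-- Alice's half of the EPR pair `e`. -/
def qA (n : ℕ) {E : Type} (e : E) : Qubit n E := .inl (.inr e)

/-- Bob's half of the EPR pair `e`. -/
def qB (n : ℕ) {E : Type} (e : E) : Qubit n E := .inr (.inl e)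

/-- Bob's message bit for the EPR pair `e`. -/
def qMsg (n : ℕ) {E : Type} (e : E) : Qubit n E := .inr (.inr e)

/-- The amplitudes of the EPR state `(|00⟩ + |11⟩)/√2`. -/
def epr (a b : Fin 2) : ℂ := if a = b then 1 / (Real.sqrt 2 : ℂ) else 0

/-- The initial joint state: the input `σ` on Alice's input qubits, EPR pairs shared by Alice
and Bob, and all the message bits equal to `0`. -/
def initialState {n : ℕ} {E : Type} [Fintype E] [DecidableEq E] (σ : Op (InputQubit n)) :
    Op (Qubit n E) :=
  Matrix.of fun x y =>
    σ (fun q => x (.inl (.inl q))) (fun q => y (.inl (.inl q))) *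
      ∏ e : E, (epr (x (qA n e)) (x (qB n e)) * star (epr (y (qA n e)) (y (qB n e))) *
        (if x (qMsg n e) = 0 ∧ y (qMsg n e) = 0 then 1 else 0))

/-! ### Alice's part of the scheme -/

/-- Alice's physical operations. -/
inductive PhysOp {n : ℕ} (c : AlmostCommutingCircuit n) : Type
  | gadget (e : Gadget c) : PhysOp c
  | fixedGate (j : ℕ) : PhysOp c

/-- Alice measures her half of the EPR pair `e` in the `Z` basis and sends the outcome `r` to
Bob (it is written into his message bit). -/
def measureAndSend {n : ℕ} {E : Type} [Fintype E] [DecidableEq E] (e : E)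
    (ρ : Op (Qubit n E)) : Op (Qubit n E) :=
  ∑ r : Fin 2, applyOp (onQubit (qMsg n e) (if r = 1 then sigmaX else 1) *
    onQubit (qA n e) (proj r)) ρ

/-- Alice's part of the gate gadget `e`: controlled-`iσ_y` with her EPR qubit as the control and
the data qubit as the target, `R_y(π/2)` on the EPR qubit, and then its measurement. -/
def gadgetChannel {n : ℕ} {c : AlmostCommutingCircuit n} (e : Gadget c)
    (ρ : Op (Qubit n (Gadget c))) : Op (Qubit n (Gadget c)) :=
  measureAndSend e
    (applyOp (onQubit (qA n e) (Ry (Real.pi / 2)))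
      (applyOp (controlled (qA n e) (qData (Gadget c) e.2.val) (Complex.I • sigmaY)) ρ))

/-- The action of a physical operation on the joint state; the fixed gates are the
controlled-`R_y(jπ)` gates with the first data qubit as the control and the phase qubit as the
target. -/
def PhysOp.channel {n : ℕ} [NeZero n] {c : AlmostCommutingCircuit n} :
    PhysOp c → Op (Qubit n (Gadget c)) → Op (Qubit n (Gadget c))
  | .gadget e => gadgetChannel e
  | .fixedGate j =>
      applyOp (controlled (qData (Gadget c) 0) (qPhase n (Gadget c)) (Ry (j * Real.pi)))

/-- The fixed gates of a layer: `R_z(jπ/2)` on the first data qubit becomes controlled-`R_y(jπ)`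
in the rebit formalism. -/
def Layer.fixedGates {n : ℕ} {c : AlmostCommutingCircuit n} : Layer n → List (PhysOp c)
  | .ydiag _ _ _ => []
  | .rz j _ => [.fixedGate j]

/-- Alice's physical operations in a given layer. -/
def layerOps {n : ℕ} (c : AlmostCommutingCircuit n) (l : Fin c.length) : List (PhysOp c) :=
  (Finset.univ.sort fun i j : {k : Fin n // k ∈ (c.get l).support} => i ≤ j).map
    (fun k => .gadget ⟨l, k⟩) ++ (c.get l).fixedGates

/-- Alice's physical circuit. -/
def physicalCircuit {n : ℕ} (c : AlmostCommutingCircuit n) : List (PhysOp c) :=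
  (List.finRange c.length).flatMap (layerOps c)

/-- The ciphertext: the joint state of Alice and Bob after Alice, with the input state `σ`, has
done her part of the scheme and has sent all her measurement outcomes to Bob. -/
def ciphertext {n : ℕ} [NeZero n] (c : AlmostCommutingCircuit n) (σ : Op (InputQubit n)) :
    Op (Qubit n (Gadget c)) :=
  (physicalCircuit c).foldl (fun ρ o => o.channel ρ) (initialState σ)

/-- Bob's reduced density operator: the partial trace over Alice's qubits. -/
def bobReduced {n : ℕ} {E : Type} [Fintype E] [DecidableEq E] (ρ : Op (Qubit n E)) :
    Op (BobQubit E) :=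
  Matrix.of fun b b' => ∑ a : AliceQubit n E → Fin 2, ρ (Sum.elim a b) (Sum.elim a b')

/-! ### The allowed input states -/

/-- The rebit form `a|0⟩|R⟩ + b|0⟩|I⟩ + c|1⟩|R⟩ + d|1⟩|I⟩` of the one-qubit state
`(a + bi)|0⟩ + (c + di)|1⟩`, where `|R⟩ = |0⟩` and `|I⟩ = |1⟩` on the phase qubit. -/
def rebit (α : Fin 2 → ℂ) (x p : Fin 2) : ℂ :=
  if p = 0 then ((α x).re : ℂ) else ((α x).im : ℂ)

/-- A real product state `v 0 ⊗ ⋯ ⊗ v (n-1)` of the data qubits, the phase qubit being `|0⟩`. -/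
def realProduct {n : ℕ} (v : Fin n → Fin 2 → ℝ) : (InputQubit n → Fin 2) → ℂ :=
  fun x => (∏ k, (v k (x (.inl k)) : ℂ)) * (if x (.inr ()) = 0 then 1 else 0)

/-- The rebit form of a one-qubit state `α` on the first data qubit and the phase qubit,
together with real states `v k` of the other data qubits. -/
def rebitProduct {n : ℕ} [NeZero n] (α : Fin 2 → ℂ) (v : Fin n → Fin 2 → ℝ) :
    (InputQubit n → Fin 2) → ℂ :=
  fun x => rebit α (x (.inl 0)) (x (.inr ())) *
    ∏ k ∈ Finset.univ.erase (0 : Fin n), (v k (x (.inl k)) : ℂ)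

/-- The allowed pure input states. -/
inductive IsAllowedPure {n : ℕ} [NeZero n] : ((InputQubit n → Fin 2) → ℂ) → Prop
  | real (v : Fin n → Fin 2 → ℝ) (hv : ∀ k, ∑ i, v k i ^ 2 = 1) :
      IsAllowedPure (realProduct v)
  | complex (α : Fin 2 → ℂ) (v : Fin n → Fin 2 → ℝ) (hα : ∑ i, ‖α i‖ ^ 2 = 1)
      (hv : ∀ k, k ≠ 0 → ∑ i, v k i ^ 2 = 1) : IsAllowedPure (rebitProduct α v)

/-- The allowed input states: the density operators of the allowed pure states and their
probabilistic mixtures. -/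
def allowedInputs (n : ℕ) [NeZero n] : Set (Op (InputQubit n)) :=
  convexHull ℝ {σ | ∃ ψ, IsAllowedPure ψ ∧ σ = Matrix.vecMulVec ψ (star ψ)}

end

end QHE

/-!
Conditioned on Bob's halves of the EPR pairs and on the outcomes, Alice's operations act on her
input by products of `iσ_y` on the data qubits and of the fixed gates, so security is a statement
about which unitaries Alice may apply to her input without Bob noticing. The proof exhibits a class
of such unitaries (`IsSymmetry`) that is large enough to connect all the allowed pure states.

A symmetry commutes with `iσ_y` on each data qubit, with everything on the EPR pairs and on the
message bits, and with `σ_x` on the first data qubit times `iσ_y` on the phase qubit. Hence it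
commutes with the gate gadgets. A controlled-`R_y(jπ)` gate, which is a controlled-`±iσ_y` gate,
exchanges up to sign the operator `iσ_y` on the first data qubit with that last operator
(`sigmaJ_mul_controlled`, `sigmaX_mul_controlled`), so conjugation by it maps symmetries to
symmetries. A symmetry before Alice's operations can therefore be moved behind them, where it is
a unitary on Alice's side and does not change Bob's state (`bobReduced_foldl_applyOp`).

On the data qubits other than the first one the real rotations are symmetries, and they act
transitively on the real unit vectors. On the first data qubit and the phase qubit, the operators
`iσ_y ⊗ 1`, `σ_x ⊗ iσ_y` and their product span, with the identity, a copy of the quaternions. Its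
commutant among the real matrices is another copy of the quaternions, whose unit elements
(`quaternion`) act transitively on the real unit vectors of `ℝ⁴`, that is, on the rebit forms.
So Bob's state is the one for the input `|0⋯0⟩` for every allowed pure input; mixtures follow since
Bob's state depends linearly on the input.
-/

namespace QHE

open Matrix

/-! ### Operators on a single qubit of a register -/

section OneQubit

variable {Q : Type} [Fintype Q] [DecidableEq Q]

theorem onQubit_mulVec (q : Q) (M : Matrix (Fin 2) (Fin 2) ℂ) (ψ : (Q → Fin 2) → ℂ)
    (x : Q → Fin 2) :
    (onQubit q M *ᵥ ψ) x = ∑ j, M (x q) j * ψ (Function.update x q j) := by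
  have key : ∀ y : Q → Fin 2, onQubit q M x y * ψ y =
      ∑ j, if y = Function.update x q j then M (x q) j * ψ (Function.update x q j) else 0 := by
    intro y
    by_cases h : ∀ p, p ≠ q → x p = y p
    · have hy : y = Function.update x q (y q) := by
        funext p
        by_cases hp : p = q
        · subst hp; simp
        · simp [hp, h p hp]
      rw [Finset.sum_eq_single (y q)]
      · rw [if_pos hy, ← hy]
        simp only [onQubit, of_apply]
        rw [if_pos h]
      · intro j _ hj
        rw [if_neg]
        intro h'
        apply hj
        rw [h']
        simp
      · simp
    · rw [Finset.sum_eq_zero]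
      · simp only [onQubit, of_apply]
        rw [if_neg h, zero_mul]
      · intro j _
        rw [if_neg]
        rintro rfl
        exact h fun p hp => by simp [hp]
  simp only [mulVec, dotProduct, key]
  rw [Finset.sum_comm]
  simp

theorem op_ext_mulVec {A B : Op Q} (h : ∀ ψ x, (A *ᵥ ψ) x = (B *ᵥ ψ) x) : A = B :=
  Matrix.ext_of_mulVec_single fun _ => funext fun x => h _ x

theorem onQubit_mul (q : Q) (M N : Matrix (Fin 2) (Fin 2) ℂ) :
    onQubit q M * onQubit q N = onQubit q (M * N) := by
  apply op_ext_mulVec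
  intro ψ x
  rw [← mulVec_mulVec]
  simp only [onQubit_mulVec, Function.update_self, Function.update_idem, mul_apply,
    Fin.sum_univ_two]
  ring

theorem onQubit_commute {p q : Q} (h : p ≠ q) (M N : Matrix (Fin 2) (Fin 2) ℂ) :
    Commute (onQubit p M) (onQubit q N) := by
  apply op_ext_mulVec
  intro ψ x
  rw [← mulVec_mulVec, ← mulVec_mulVec]
  simp only [onQubit_mulVec, Function.update_of_ne h, Function.update_of_ne h.symm,
    Fin.sum_univ_two, Function.update_comm h]
  ring

theorem onQubit_commute_same (q : Q) {M N : Matrix (Fin 2) (Fin 2) ℂ} (h : M * N = N * M) :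
    Commute (onQubit q M) (onQubit q N) := by
  rw [Commute, SemiconjBy, onQubit_mul, onQubit_mul, h]

theorem onQubit_one (q : Q) : onQubit q 1 = (1 : Op Q) := by
  apply op_ext_mulVec
  intro ψ x
  simp [onQubit_mulVec, one_apply]

theorem onQubit_neg (q : Q) (M : Matrix (Fin 2) (Fin 2) ℂ) :
    onQubit q (-M) = -onQubit q M := by
  ext x y
  simp only [onQubit, of_apply, Matrix.neg_apply]
  split_ifs <;> simp

theorem onQubit_add (q : Q) (M N : Matrix (Fin 2) (Fin 2) ℂ) :
    onQubit q (M + N) = onQubit q M + onQubit q N := by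
  ext x y
  simp only [onQubit, of_apply, Matrix.add_apply]
  split_ifs <;> simp

theorem onQubit_conjTranspose (q : Q) (M : Matrix (Fin 2) (Fin 2) ℂ) :
    (onQubit q M)ᴴ = onQubit q Mᴴ := by
  ext x y
  simp only [onQubit, of_apply, conjTranspose_apply]
  have : (∀ p, p ≠ q → y p = x p) ↔ ∀ p, p ≠ q → x p = y p :=
    forall₂_congr fun _ _ => eq_comm
  simp only [this]
  split_ifs <;> simp

theorem applyOp_mul (A B ρ : Op Q) : applyOp (A * B) ρ = applyOp A (applyOp B ρ) := by
  simp only [applyOp, conjTranspose_mul, Matrix.mul_assoc]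

theorem applyOp_comm {A B : Op Q} (h : Commute A B) (ρ : Op Q) :
    applyOp A (applyOp B ρ) = applyOp B (applyOp A ρ) := by
  rw [← applyOp_mul, ← applyOp_mul, h.eq]

theorem applyOp_add (A ρ ρ' : Op Q) : applyOp A (ρ + ρ') = applyOp A ρ + applyOp A ρ' := by
  simp only [applyOp, Matrix.mul_add, Matrix.add_mul]

theorem applyOp_smul (A : Op Q) (t : ℝ) (ρ : Op Q) : applyOp A (t • ρ) = t • applyOp A ρ := by
  simp only [applyOp, Matrix.mul_smul, Matrix.smul_mul]

theorem applyOp_vecMulVec (A : Op Q) (ψ : (Q → Fin 2) → ℂ) :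
    applyOp A (vecMulVec ψ (star ψ)) = vecMulVec (A *ᵥ ψ) (star (A *ᵥ ψ)) := by
  rw [applyOp, mul_vecMulVec, vecMulVec_mul, star_mulVec]

end OneQubit

/-! ### Pauli matrices -/

/-- The real matrix `iσ_y`, a square root of `-1`. -/
def sigmaJ : Matrix (Fin 2) (Fin 2) ℂ := !![0, 1; -1, 0]

/-- The Pauli matrix `σ_z`. -/
def sigmaZ : Matrix (Fin 2) (Fin 2) ℂ := !![1, 0; 0, -1]

theorem I_smul_sigmaY : Complex.I • sigmaY = sigmaJ := by
  ext i j
  fin_cases i <;> fin_cases j <;> simp [sigmaY, sigmaJ]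

theorem sigmaJ_mul_self : sigmaJ * sigmaJ = -1 := by
  ext i j
  fin_cases i <;> fin_cases j <;> simp [sigmaJ]

theorem sigmaX_mul_self : sigmaX * sigmaX = 1 := by
  ext i j
  fin_cases i <;> fin_cases j <;> simp [sigmaX]

theorem sigmaZ_mul_self : sigmaZ * sigmaZ = 1 := by
  ext i j
  fin_cases i <;> fin_cases j <;> simp [sigmaZ]

theorem sigmaX_mul_sigmaJ : sigmaX * sigmaJ = -(sigmaJ * sigmaX) := by
  ext i j
  fin_cases i <;> fin_cases j <;> simp [sigmaX, sigmaJ]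

theorem sigmaZ_mul_sigmaJ : sigmaZ * sigmaJ = -(sigmaJ * sigmaZ) := by
  ext i j
  fin_cases i <;> fin_cases j <;> simp [sigmaZ, sigmaJ]

theorem sigmaZ_mul_sigmaX : sigmaZ * sigmaX = -(sigmaX * sigmaZ) := by
  ext i j
  fin_cases i <;> fin_cases j <;> simp [sigmaZ, sigmaX]

theorem sigmaJ_conjTranspose : sigmaJᴴ = -sigmaJ := by
  ext i j
  fin_cases i <;> fin_cases j <;> simp [sigmaJ]

theorem sigmaX_conjTranspose : sigmaXᴴ = sigmaX := by
  ext i j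
  fin_cases i <;> fin_cases j <;> simp [sigmaX]

theorem sigmaZ_conjTranspose : sigmaZᴴ = sigmaZ := by
  ext i j
  fin_cases i <;> fin_cases j <;> simp [sigmaZ]

theorem Ry_fixedGate {j : ℕ} (hj : j = 1 ∨ j = 3) :
    Ry (j * Real.pi) = sigmaJ ∨ Ry (j * Real.pi) = -sigmaJ := by
  rcases hj with rfl | rfl
  · right
    ext a b
    fin_cases a <;> fin_cases b <;> simp [Ry, sigmaJ]
  · left
    have h : (3 : ℝ) * Real.pi / 2 = Real.pi / 2 + Real.pi := by ring
    ext a b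
    fin_cases a <;> fin_cases b <;>
      simp [Ry, sigmaJ, h, Real.cos_add_pi, Real.sin_add_pi, -Complex.ofReal_cos,
        -Complex.ofReal_sin]

/-! ### Conjugation by the fixed gates -/

section Controlled

variable {Q : Type} [Fintype Q] [DecidableEq Q]

theorem onQubit_mul_mul {p q : Q} (h : p ≠ q) (M N M' N' : Matrix (Fin 2) (Fin 2) ℂ) :
    (onQubit p M * onQubit q N) * (onQubit p M' * onQubit q N') =
      onQubit p (M * M') * onQubit q (N * N') := by
  rw [mul_assoc, ← mul_assoc (onQubit q N), ← (onQubit_commute h M' N).eq, ← onQubit_mul,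
    ← onQubit_mul]
  simp only [mul_assoc]

theorem onQubit_mul_conjTranspose {p q : Q} (h : p ≠ q) (M N : Matrix (Fin 2) (Fin 2) ℂ) :
    (onQubit p M * onQubit q N)ᴴ = onQubit p Mᴴ * onQubit q Nᴴ := by
  rw [conjTranspose_mul, onQubit_conjTranspose, onQubit_conjTranspose,
    (onQubit_commute h _ _).eq]

theorem controlled_eq (p q : Q) (K : Matrix (Fin 2) (Fin 2) ℂ) :
    controlled p q K = onQubit p (proj 0) * onQubit q 1 + onQubit p (proj 1) * onQubit q K := by
  rw [controlled, onQubit_one, mul_one]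

/-- Conjugation by a controlled-`K` gate with `K² = -1` exchanges, up to sign, `iσ_y` on the
control with `σ_x` on the control times `K` on the target. -/
theorem sigmaJ_mul_controlled {p q : Q} (h : p ≠ q) {K : Matrix (Fin 2) (Fin 2) ℂ}
    (hK : K * K = -1) :
    onQubit p sigmaJ * controlled p q K =
      controlled p q K * (onQubit p sigmaX * onQubit q K) := by
  have e1 : sigmaJ * proj 0 = -(proj 1 * sigmaX) := by
    ext i j; fin_cases i <;> fin_cases j <;> simp [sigmaJ, sigmaX, proj, mul_apply, single_apply]
  have e2 : sigmaJ * proj 1 = proj 0 * sigmaX := by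
    ext i j; fin_cases i <;> fin_cases j <;> simp [sigmaJ, sigmaX, proj, mul_apply, single_apply]
  rw [← mul_one (onQubit p sigmaJ), ← onQubit_one q, controlled_eq]
  simp only [add_mul, mul_add, onQubit_mul_mul h, e1, e2, hK, one_mul, onQubit_neg, neg_mul,
    mul_neg]
  exact add_comm _ _

theorem sigmaX_mul_controlled {p q : Q} (h : p ≠ q) {K : Matrix (Fin 2) (Fin 2) ℂ}
    (hK : K * K = -1) :
    (onQubit p sigmaX * onQubit q K) * controlled p q K =
      controlled p q K * -onQubit p sigmaJ := by
  have e1 : sigmaX * proj 0 = -(proj 1 * sigmaJ) := by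
    ext i j; fin_cases i <;> fin_cases j <;> simp [sigmaJ, sigmaX, proj, mul_apply, single_apply]
  have e2 : sigmaX * proj 1 = proj 0 * sigmaJ := by
    ext i j; fin_cases i <;> fin_cases j <;> simp [sigmaJ, sigmaX, proj, mul_apply, single_apply]
  rw [← mul_one (onQubit p sigmaJ), ← onQubit_one q, controlled_eq, mul_neg]
  simp only [add_mul, mul_add, onQubit_mul_mul h, e1, e2, hK, mul_one, onQubit_neg,
    neg_mul, mul_neg, neg_add]
  exact add_comm _ _

theorem controlled_mem_unitaryGroup {p q : Q} (h : p ≠ q) {K : Matrix (Fin 2) (Fin 2) ℂ}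
    (hK : K * Kᴴ = 1) : controlled p q K ∈ unitaryGroup (Q → Fin 2) ℂ := by
  have pc (r : Fin 2) : (proj r)ᴴ = proj r := by simp [proj]
  have z01 : proj 0 * proj 1 = 0 := by simp [proj]
  have z10 : proj 1 * proj 0 = 0 := by simp [proj]
  have z00 : proj 0 * proj 0 = proj 0 := by simp [proj]
  have z11 : proj 1 * proj 1 = proj 1 := by simp [proj]
  have z : proj 0 + proj 1 = 1 := by
    ext i j; fin_cases i <;> fin_cases j <;> simp [proj]
  have zero : onQubit p 0 = (0 : Op Q) := by
    ext x y; simp [onQubit]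
  rw [mem_unitaryGroup_iff, star_eq_conjTranspose, controlled_eq, conjTranspose_add]
  simp only [onQubit_mul_conjTranspose h, pc, conjTranspose_one, add_mul, mul_add,
    onQubit_mul_mul h, z00, z01, z10, z11, zero, hK, one_mul, mul_one, zero_mul, add_zero,
    zero_add]
  rw [← add_mul, ← onQubit_add, z, onQubit_one, onQubit_one, one_mul]

theorem Commute.controlled {R : Op Q} {p q : Q} {M : Matrix (Fin 2) (Fin 2) ℂ}
    (h : ∀ N, Commute R (onQubit p N)) (h' : Commute R (onQubit q M)) :
    Commute R (QHE.controlled p q M) :=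
  (h _).add_right ((h _).mul_right h')

end Controlled

/-! ### Operators that Bob cannot see -/

section Symmetry

variable {n : ℕ} {E : Type} [Fintype E] [DecidableEq E]

/-- The matrix unit `|b⟩⟨b'|` on Bob's qubits, the identity on Alice's. -/
def bobUnit (b b' : BobQubit E → Fin 2) : Op (Qubit n E) :=
  Matrix.of fun x y =>
    if y = Sum.elim (fun q => x (.inl q)) b' ∧ (fun q => x (.inr q)) = b then 1 else 0

theorem bobUnit_mulVec (b b' : BobQubit E → Fin 2) (ψ : (Qubit n E → Fin 2) → ℂ)
    (x : Qubit n E → Fin 2) :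
    (bobUnit b b' *ᵥ ψ) x =
      if (fun q => x (.inr q)) = b then ψ (Sum.elim (fun q => x (.inl q)) b') else 0 := by
  simp only [mulVec, dotProduct, bobUnit, of_apply]
  split_ifs with hb
  · rw [Finset.sum_eq_single (Sum.elim (fun q => x (.inl q)) b')
      (fun y _ hy => by rw [if_neg fun h => hy h.1, zero_mul]) (by simp),
      if_pos ⟨rfl, hb⟩, one_mul]
  · exact Finset.sum_eq_zero fun y _ => by rw [if_neg fun h => hb h.2, zero_mul]

theorem onQubit_commute_bobUnit (q : AliceQubit n E) (M : Matrix (Fin 2) (Fin 2) ℂ)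
    (b b' : BobQubit E → Fin 2) :
    Commute (onQubit (.inl q : Qubit n E) M) (bobUnit b b') := by
  apply op_ext_mulVec
  intro ψ x
  rw [← mulVec_mulVec, ← mulVec_mulVec]
  have h (j : Fin 2) :
      (Sum.elim (fun a => Function.update x (.inl q) j (.inl a)) b' : Qubit n E → Fin 2) =
      Function.update (Sum.elim (fun a => x (.inl a)) b') (.inl q) j := by
    funext a
    rcases a with a | a
    · by_cases ha : a = q
      · subst ha; simp
      · simp [ha]
    · simp
  have h' (j : Fin 2) :
      (fun a => Function.update x (.inl q : Qubit n E) j (.inr a)) = fun a => x (.inr a) := by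
    funext a
    simp
  simp only [onQubit_mulVec, bobUnit_mulVec, h, h', Sum.elim_inl]
  by_cases hb : (fun a => x (.inr a)) = b
  · simp only [if_pos hb]
  · simp only [if_neg hb, mul_zero, Finset.sum_const_zero]

theorem bobReduced_apply_eq_trace (ρ : Op (Qubit n E)) (b b' : BobQubit E → Fin 2) :
    bobReduced ρ b b' = (bobUnit b' b * ρ).trace := by
  have h (x : Qubit n E → Fin 2) : ((bobUnit b' b : Op (Qubit n E)) * ρ) x x =
      if (fun q => x (.inr q)) = b' then ρ (Sum.elim (fun q => x (.inl q)) b) x else 0 :=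
    bobUnit_mulVec b' b (fun y => ρ y x) x
  rw [Matrix.trace, ← (Equiv.sumArrowEquivProdArrow (AliceQubit n E) (BobQubit E)
    (Fin 2)).symm.sum_comp, Fintype.sum_prod_type]
  refine Finset.sum_congr rfl fun a _ => ?_
  refine ((Finset.sum_eq_single b' (fun y _ hy => ?_) (by simp)).trans ?_).symm
  · exact (h (Sum.elim a y)).trans (if_neg hy)
  · exact (h (Sum.elim a b')).trans (if_pos rfl)

/-- The unitaries which commute with the operators on Bob's side and with everything that Alice
applies in the gate gadgets, and with `σ_x` on the first data qubit times `iσ_y` on the phase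
qubit. The last operator makes this class invariant under conjugation by the fixed gates. -/
structure IsSymmetry [NeZero n] (R : Op (Qubit n E)) : Prop where
  unitary : R ∈ unitaryGroup (Qubit n E → Fin 2) ℂ
  bob : ∀ b b', Commute R (bobUnit b b')
  epr : ∀ e M, Commute R (onQubit (qA n e) M)
  msg : ∀ e M, Commute R (onQubit (qMsg n e) M)
  data : ∀ k, Commute R (onQubit (qData E k) sigmaJ)
  phase : Commute R (onQubit (qData E 0) sigmaX * onQubit (qPhase n E) sigmaJ)

theorem bobReduced_applyOp {R : Op (Qubit n E)} (hR : R ∈ unitaryGroup (Qubit n E → Fin 2) ℂ)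
    (hb : ∀ b b', Commute R (bobUnit b b')) (ρ : Op (Qubit n E)) :
    bobReduced (applyOp R ρ) = bobReduced ρ := by
  ext b b'
  rw [mem_unitaryGroup_iff', star_eq_conjTranspose] at hR
  rw [bobReduced_apply_eq_trace, bobReduced_apply_eq_trace, applyOp, mul_assoc, ← mul_assoc,
    ← (hb b' b).eq, mul_assoc, trace_mul_comm, mul_assoc, mul_assoc, hR, mul_one]

/-- If `hC = Ch'` for a unitary `C`, then conjugation by `C` takes the operators commuting with
`h'` to operators commuting with `h`. -/
theorem commute_conj {Q : Type} [Fintype Q] [DecidableEq Q] {C R h h' : Op Q}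
    (hC : C ∈ unitaryGroup (Q → Fin 2) ℂ) (hh : h * C = C * h') (hR : Commute R h') :
    Commute (C * R * Cᴴ) h := by
  have h1 := mem_unitaryGroup_iff.1 hC
  have h2 := mem_unitaryGroup_iff'.1 hC
  rw [star_eq_conjTranspose] at h1 h2
  have h3 : Cᴴ * h = h' * Cᴴ := by
    calc Cᴴ * h = Cᴴ * (h * C) * Cᴴ := by rw [mul_assoc, mul_assoc, h1, mul_one]
      _ = h' * Cᴴ := by rw [hh, ← mul_assoc, h2, one_mul]
  calc C * R * Cᴴ * h = C * (R * h') * Cᴴ := by rw [mul_assoc, h3]; simp only [mul_assoc]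
    _ = h * (C * R * Cᴴ) := by rw [hR.eq]; simp only [← mul_assoc, hh]

omit [Fintype E] [DecidableEq E] in
theorem qData_ne_qPhase (k : Fin n) : qData E k ≠ qPhase n E := by simp [qData, qPhase]

theorem IsSymmetry.conj_controlled [NeZero n] {R : Op (Qubit n E)} (hR : IsSymmetry R)
    {K : Matrix (Fin 2) (Fin 2) ℂ} (hK : K = sigmaJ ∨ K = -sigmaJ) :
    IsSymmetry (controlled (qData E 0) (qPhase n E) K * R *
      (controlled (qData E 0) (qPhase n E) K)ᴴ) := by
  have hne := qData_ne_qPhase (E := E) (0 : Fin n)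
  have hKK : K * K = -1 := by rcases hK with rfl | rfl <;> simp [sigmaJ_mul_self]
  have hKu : K * Kᴴ = 1 := by
    rcases hK with rfl | rfl <;> simp [sigmaJ_conjTranspose, sigmaJ_mul_self]
  have hU := controlled_mem_unitaryGroup hne hKu
  have hphase : Commute R (onQubit (qData E 0) sigmaX * onQubit (qPhase n E) K) := by
    rcases hK with rfl | rfl
    · exact hR.phase
    · rw [onQubit_neg, mul_neg]
      exact hR.phase.neg_right
  have comm {A : Op (Qubit n E)} (h0 : ∀ N, Commute A (onQubit (qData E 0) N))
      (h1 : Commute A (onQubit (qPhase n E) K)) (hA : Commute R A) :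
      Commute (controlled (qData E 0) (qPhase n E) K * R *
        (controlled (qData E 0) (qPhase n E) K)ᴴ) A :=
    commute_conj hU (Commute.controlled h0 h1).eq hA
  refine ⟨?_, fun b b' => ?_, fun e M => ?_, fun e M => ?_, fun k => ?_, ?_⟩
  · exact mul_mem (mul_mem hU hR.unitary) (Unitary.star_mem hU)
  · exact comm (fun N => (onQubit_commute_bobUnit _ _ _ _).symm)
      (onQubit_commute_bobUnit _ _ _ _).symm (hR.bob b b')
  · exact comm (fun N => onQubit_commute (by simp [qA, qData]) _ _)
      (onQubit_commute (by simp [qA, qPhase]) _ _) (hR.epr e M)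
  · exact comm (fun N => onQubit_commute (by simp [qMsg, qData]) _ _)
      (onQubit_commute (by simp [qMsg, qPhase]) _ _) (hR.msg e M)
  · by_cases hk : k = 0
    · subst hk
      exact commute_conj hU (sigmaJ_mul_controlled hne hKK) hphase
    · exact comm (fun N => onQubit_commute (by simp [qData, hk]) _ _)
        (onQubit_commute (qData_ne_qPhase k) _ _) (hR.data k)
  · have := commute_conj hU (sigmaX_mul_controlled hne hKK) (hR.data 0).neg_right
    rcases hK with rfl | rfl
    · exact this
    · rw [onQubit_neg, mul_neg] at this
      exact (Commute.neg_right_iff).1 this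

end Symmetry

/-! ### Covariance of Alice's operations -/

section Covariance

variable {n : ℕ} [NeZero n] {c : AlmostCommutingCircuit n}

theorem measureAndSend_applyOp {E : Type} [Fintype E] [DecidableEq E] {R : Op (Qubit n E)}
    (hR : IsSymmetry R) (e : E) (ρ : Op (Qubit n E)) :
    measureAndSend e (applyOp R ρ) = applyOp R (measureAndSend e ρ) := by
  simp only [measureAndSend, Fin.sum_univ_two, applyOp_add]
  rw [applyOp_comm ((hR.msg e _).mul_right (hR.epr e _)).symm,
    applyOp_comm ((hR.msg e _).mul_right (hR.epr e _)).symm]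

theorem gadgetChannel_applyOp {R : Op (Qubit n (Gadget c))} (hR : IsSymmetry R) (e : Gadget c)
    (ρ : Op (Qubit n (Gadget c))) :
    gadgetChannel e (applyOp R ρ) = applyOp R (gadgetChannel e ρ) := by
  simp only [gadgetChannel, I_smul_sigmaY]
  rw [applyOp_comm (Commute.controlled (hR.epr e) (hR.data _)).symm,
    applyOp_comm (hR.epr e _).symm, measureAndSend_applyOp hR]

omit [NeZero n] in
theorem physicalCircuit_fixedGate {j : ℕ} (h : PhysOp.fixedGate j ∈ physicalCircuit c) :
    j = 1 ∨ j = 3 := by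
  simp only [physicalCircuit, List.mem_flatMap, layerOps, List.mem_append, List.mem_map] at h
  obtain ⟨l, -, ⟨k, -, hk⟩ | h⟩ := h
  · cases hk
  · generalize c.get l = L at h
    cases L with
    | ydiag S U hU => simp [Layer.fixedGates] at h
    | rz i hi =>
      simp only [Layer.fixedGates, List.mem_singleton, PhysOp.fixedGate.injEq] at h
      exact h ▸ hi

/-- Bob's state is not changed by a symmetry applied before any sequence of Alice's operations:
the gadgets commute with it, and the fixed gates replace it by another symmetry. -/
theorem bobReduced_foldl_applyOp (l : List (PhysOp c))
    (hl : ∀ j, PhysOp.fixedGate j ∈ l → j = 1 ∨ j = 3) {R : Op (Qubit n (Gadget c))}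
    (hR : IsSymmetry R) (ρ : Op (Qubit n (Gadget c))) :
    bobReduced (l.foldl (fun ρ o => o.channel ρ) (applyOp R ρ)) =
      bobReduced (l.foldl (fun ρ o => o.channel ρ) ρ) := by
  induction l generalizing R ρ with
  | nil => exact bobReduced_applyOp hR.unitary hR.bob ρ
  | cons o l ih =>
    have hl' : ∀ j, PhysOp.fixedGate j ∈ l → j = 1 ∨ j = 3 :=
      fun j hj => hl j (List.mem_cons_of_mem _ hj)
    cases o with
    | gadget e =>
      have hch (ρ) : (PhysOp.gadget e).channel ρ = gadgetChannel e ρ := rfl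
      simp only [List.foldl_cons]
      rw [hch, hch, gadgetChannel_applyOp hR]
      exact ih hl' hR _
    | fixedGate j =>
      have hK := Ry_fixedGate (hl j List.mem_cons_self)
      have hKu : Ry (j * Real.pi) * (Ry (j * Real.pi))ᴴ = 1 := by
        rcases hK with h | h <;> simp [h, sigmaJ_conjTranspose, sigmaJ_mul_self]
      have hU := mem_unitaryGroup_iff'.1
        (controlled_mem_unitaryGroup (qData_ne_qPhase (E := Gadget c) (0 : Fin n)) hKu)
      rw [star_eq_conjTranspose] at hU
      have hch (ρ) : (PhysOp.fixedGate j : PhysOp c).channel ρ = applyOp (controlled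
          (qData (Gadget c) 0) (qPhase n (Gadget c)) (Ry (j * Real.pi))) ρ := rfl
      simp only [List.foldl_cons]
      rw [hch, hch]
      refine Eq.trans ?_ (ih hl' (hR.conj_controlled hK) _)
      rw [← applyOp_mul, ← applyOp_mul, mul_assoc _ _ᴴ, hU, mul_one]

theorem channel_add (o : PhysOp c) (ρ ρ' : Op (Qubit n (Gadget c))) :
    o.channel (ρ + ρ') = o.channel ρ + o.channel ρ' := by
  cases o with
  | gadget e =>
    simp only [PhysOp.channel, gadgetChannel, measureAndSend, applyOp_add, Finset.sum_add_distrib]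
  | fixedGate j => exact applyOp_add _ _ _

theorem channel_smul (o : PhysOp c) (t : ℝ) (ρ : Op (Qubit n (Gadget c))) :
    o.channel (t • ρ) = t • o.channel ρ := by
  cases o with
  | gadget e =>
    simp only [PhysOp.channel, gadgetChannel, measureAndSend, applyOp_smul, Finset.smul_sum]
  | fixedGate j => exact applyOp_smul _ _ _

omit [NeZero n] in
theorem initialState_add_smul (s t : ℝ) (σ σ' : Op (InputQubit n)) :
    initialState (E := Gadget c) (s • σ + t • σ') =
      s • initialState σ + t • initialState σ' := by
  ext x y
  simp [initialState, add_mul, mul_assoc]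

theorem bobReduced_ciphertext_add_smul (s t : ℝ) (σ σ' : Op (InputQubit n)) :
    bobReduced (ciphertext c (s • σ + t • σ')) =
      s • bobReduced (ciphertext c σ) + t • bobReduced (ciphertext c σ') := by
  have h (l : List (PhysOp c)) (ρ ρ' : Op (Qubit n (Gadget c))) :
      l.foldl (fun ρ o => o.channel ρ) (s • ρ + t • ρ') =
        s • l.foldl (fun ρ o => o.channel ρ) ρ + t • l.foldl (fun ρ o => o.channel ρ) ρ' := by
    induction l generalizing ρ ρ' with
    | nil => rfl
    | cons o l ih => simp only [List.foldl_cons, channel_add, channel_smul, ih]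
  simp only [ciphertext, initialState_add_smul, h]
  ext b b'
  simp [bobReduced, Finset.sum_add_distrib, Finset.mul_sum]

end Covariance

/-! ### Symmetries connecting the allowed input states -/

section Inputs

variable {n : ℕ} {E : Type} [Fintype E] [DecidableEq E]

/-- The state vector of all the qubits for the input state vector `ψ`. -/
noncomputable def initialVec (ψ : (InputQubit n → Fin 2) → ℂ) (x : Qubit n E → Fin 2) : ℂ :=
  ψ (fun q => x (.inl (.inl q))) *
    ∏ e : E, (epr (x (qA n e)) (x (qB n e)) * (if x (qMsg n e) = 0 then 1 else 0))

theorem initialState_vecMulVec (ψ : (InputQubit n → Fin 2) → ℂ) :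
    initialState (E := E) (vecMulVec ψ (star ψ)) =
      vecMulVec (initialVec ψ) (star (initialVec ψ)) := by
  ext x y
  simp only [initialState, vecMulVec_apply, of_apply, Pi.star_apply, initialVec, star_mul',
    star_prod]
  rw [mul_mul_mul_comm, ← Finset.prod_mul_distrib]
  congr 1
  refine Finset.prod_congr rfl fun e _ => ?_
  split_ifs <;> simp_all

theorem onQubit_mulVec_initialVec (q : InputQubit n) (M : Matrix (Fin 2) (Fin 2) ℂ)
    (ψ : (InputQubit n → Fin 2) → ℂ) :
    onQubit (.inl (.inl q) : Qubit n E) M *ᵥ initialVec ψ = initialVec (onQubit q M *ᵥ ψ) := by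
  funext x
  have h (j : Fin 2) : (fun a => Function.update x (.inl (.inl q) : Qubit n E) j (.inl (.inl a))) =
      Function.update (fun a => x (.inl (.inl a))) q j := by
    funext a
    by_cases ha : a = q
    · subst ha; simp
    · simp [ha]
  simp only [onQubit_mulVec, initialVec, h, qA, qB, qMsg]
  simp only [ne_eq, reduceCtorEq, not_false_eq_true, Function.update_of_ne, Sum.inl.injEq]
  rw [Finset.sum_mul]
  exact Finset.sum_congr rfl fun j _ => (mul_assoc _ _ _).symm

variable [NeZero n]

theorem isSymmetry_rotation {k : Fin n} (hk : k ≠ 0) {a b : ℝ} (h : a ^ 2 + b ^ 2 = 1) :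
    IsSymmetry (onQubit (qData E k) !![(a : ℂ), -b; (b : ℂ), a]) := by
  have h' : (a : ℂ) ^ 2 + (b : ℂ) ^ 2 = 1 := by exact_mod_cast h
  refine ⟨?_, fun b b' => ?_, fun e M => ?_, fun e M => ?_, fun i => ?_, ?_⟩
  · rw [mem_unitaryGroup_iff, star_eq_conjTranspose, onQubit_conjTranspose, onQubit_mul,
      ← onQubit_one (qData E k)]
    congr 1
    ext i j
    fin_cases i <;> fin_cases j <;> simp [mul_apply] <;> ring_nf <;> first | done | linear_combination h'
  · exact onQubit_commute_bobUnit _ _ _ _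
  · exact onQubit_commute (by simp [qA, qData]) _ _
  · exact onQubit_commute (by simp [qMsg, qData]) _ _
  · by_cases hi : k = i
    · subst hi
      apply onQubit_commute_same
      ext i j
      fin_cases i <;> fin_cases j <;> simp [sigmaJ]
    · exact onQubit_commute (by simp [qData, hi]) _ _
  · exact (onQubit_commute (by simp [qData, hk]) _ _).mul_right
      (onQubit_commute (qData_ne_qPhase k) _ _)

/-- The quaternion `a - b j - c j' - d j''` with the imaginary units `j = iσ_y` on the phase
qubit, `j' = iσ_y ⊗ σ_z` and `j'' = iσ_y ⊗ σ_x` on a data qubit and the phase qubit.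
The signs make `a, b, c, d` the coordinates of the image of `|00⟩`, as `iσ_y|0⟩ = -|1⟩`. -/
noncomputable def quaternion {Q : Type} [Fintype Q] [DecidableEq Q] (p q : Q) (a b c d : ℝ) : Op Q :=
  a • (1 : Op Q) - b • onQubit q sigmaJ - c • (onQubit p sigmaJ * onQubit q sigmaZ) -
    d • (onQubit p sigmaJ * onQubit q sigmaX)

theorem quaternion_mem_unitaryGroup {Q : Type} [Fintype Q] [DecidableEq Q] {p q : Q}
    (hpq : p ≠ q) {a b c d : ℝ} (h : a ^ 2 + b ^ 2 + c ^ 2 + d ^ 2 = 1) :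
    quaternion p q a b c d ∈ unitaryGroup (Q → Fin 2) ℂ := by
  have hA : onQubit q sigmaJ = onQubit p 1 * onQubit q sigmaJ := by rw [onQubit_one, one_mul]
  rw [mem_unitaryGroup_iff, star_eq_conjTranspose, quaternion, hA]
  simp only [conjTranspose_sub, conjTranspose_smul, onQubit_mul_conjTranspose hpq,
    conjTranspose_one, sigmaJ_conjTranspose, sigmaX_conjTranspose, sigmaZ_conjTranspose, sub_mul,
    mul_sub, smul_mul_assoc, mul_smul_comm, onQubit_mul_mul hpq, one_mul, mul_one, mul_neg, neg_mul,
    sigmaJ_mul_self, sigmaX_mul_self, sigmaZ_mul_self, sigmaX_mul_sigmaJ, sigmaZ_mul_sigmaJ,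
    sigmaZ_mul_sigmaX, onQubit_neg, star_trivial, neg_neg]
  simp only [onQubit_one, one_mul, mul_one]
  linear_combination (norm := module) h • (1 : Op Q)

theorem isSymmetry_quaternion {a b c d : ℝ} (h : a ^ 2 + b ^ 2 + c ^ 2 + d ^ 2 = 1) :
    IsSymmetry (quaternion (qData E (0 : Fin n)) (qPhase n E) a b c d) := by
  have hne := qData_ne_qPhase (E := E) (0 : Fin n)
  have comm {A : Op (Qubit n E)} (h1 : Commute (onQubit (qPhase n E) sigmaJ) A)
      (h2 : Commute (onQubit (qData E 0) sigmaJ * onQubit (qPhase n E) sigmaZ) A)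
      (h3 : Commute (onQubit (qData E 0) sigmaJ * onQubit (qPhase n E) sigmaX) A) :
      Commute (quaternion (qData E (0 : Fin n)) (qPhase n E) a b c d) A :=
    ((((Commute.one_left A).smul_left a).sub_left (h1.smul_left b)).sub_left
      (h2.smul_left c)).sub_left (h3.smul_left d)
  have comm' {A : Op (Qubit n E)} (h1 : ∀ N, Commute (onQubit (qPhase n E) N) A)
      (h2 : Commute (onQubit (qData E 0) sigmaJ) A) :
      Commute (quaternion (qData E (0 : Fin n)) (qPhase n E) a b c d) A :=
    comm (h1 _) (h2.mul_left (h1 _)) (h2.mul_left (h1 _))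
  refine ⟨quaternion_mem_unitaryGroup hne h, fun b b' => ?_, fun e M => ?_, fun e M => ?_,
    fun i => ?_, ?_⟩
  · exact comm' (fun N => onQubit_commute_bobUnit _ _ _ _) (onQubit_commute_bobUnit _ _ _ _)
  · exact comm' (fun N => onQubit_commute (by simp [qA, qPhase]) _ _)
      (onQubit_commute (by simp [qA, qData]) _ _)
  · exact comm' (fun N => onQubit_commute (by simp [qMsg, qPhase]) _ _)
      (onQubit_commute (by simp [qMsg, qData]) _ _)
  · refine comm' (fun N => onQubit_commute (qData_ne_qPhase i).symm _ _) ?_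
    by_cases hi : 0 = i
    · subst hi; exact Commute.refl _
    · exact onQubit_commute (by simp [qData, hi]) _ _
  · apply comm
    · exact (onQubit_commute hne.symm _ _).mul_right (Commute.refl _)
    · rw [Commute, SemiconjBy, onQubit_mul_mul hne, onQubit_mul_mul hne, sigmaX_mul_sigmaJ, sigmaZ_mul_sigmaJ]
      simp [onQubit_neg]
    · rw [Commute, SemiconjBy, onQubit_mul_mul hne, onQubit_mul_mul hne, sigmaX_mul_sigmaJ]
      simp [onQubit_neg]

theorem bobReduced_ciphertext_of_isSymmetry {c : AlmostCommutingCircuit n}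
    {ψ φ : (InputQubit n → Fin 2) → ℂ} {R : Op (Qubit n (Gadget c))} (hR : IsSymmetry R)
    (h : R *ᵥ initialVec ψ = initialVec φ) :
    bobReduced (ciphertext c (vecMulVec φ (star φ))) =
      bobReduced (ciphertext c (vecMulVec ψ (star ψ))) := by
  rw [ciphertext, ciphertext, initialState_vecMulVec, initialState_vecMulVec, ← h,
    ← applyOp_vecMulVec]
  exact bobReduced_foldl_applyOp _ (fun j => physicalCircuit_fixedGate) hR _

theorem rotation_mulVec_rebitProduct {k : Fin n} (hk : k ≠ 0) (α : Fin 2 → ℂ)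
    (v : Fin n → Fin 2 → ℝ) :
    onQubit (Sum.inl k : InputQubit n) !![(v k 0 : ℂ), -v k 1; (v k 1 : ℂ), v k 0] *ᵥ
      rebitProduct α (Function.update v k ![1, 0]) = rebitProduct α v := by
  funext x
  have hmem : k ∈ Finset.univ.erase (0 : Fin n) := by simp [hk]
  have hprod (j : Fin 2) : ∏ i ∈ (Finset.univ.erase (0 : Fin n)).erase k,
      (Function.update v k ![1, 0] i (Function.update x (Sum.inl k) j (Sum.inl i)) : ℂ) =
      ∏ i ∈ (Finset.univ.erase (0 : Fin n)).erase k, (v i (x (Sum.inl i)) : ℂ) := by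
    refine Finset.prod_congr rfl fun i hi => ?_
    have hik : i ≠ k := (Finset.mem_erase.1 hi).1
    simp [hik]
  simp only [onQubit_mulVec, rebitProduct, ← Finset.mul_prod_erase _ _ hmem, hprod,
    Fin.sum_univ_two]
  have : ((0 : Fin n) = k) = False := by simp [hk.symm]
  have hx : x (Sum.inl k) = 0 ∨ x (Sum.inl k) = 1 := by omega
  rcases hx with hx | hx <;> simp [hx, this] <;> ring

theorem quaternion_mulVec_rebitProduct (α : Fin 2 → ℂ) (v : Fin n → Fin 2 → ℝ) :
    quaternion (Sum.inl 0 : InputQubit n) (Sum.inr ()) (α 0).re (α 0).im (α 1).re (α 1).im *ᵥ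
      rebitProduct ![1, 0] v = rebitProduct α v := by
  funext x
  have hprod (j : Fin 2) : ∏ i ∈ Finset.univ.erase (0 : Fin n),
      (v i (Function.update (x ∘ Sum.inl) 0 j i) : ℂ) =
      ∏ i ∈ Finset.univ.erase (0 : Fin n), (v i (x (Sum.inl i)) : ℂ) :=
    Finset.prod_congr rfl fun i hi => by simp [(Finset.mem_erase.1 hi).1]
  have hx : x (Sum.inl 0) = 0 ∨ x (Sum.inl 0) = 1 := by omega
  have hp : x (Sum.inr ()) = 0 ∨ x (Sum.inr ()) = 1 := by omega
  simp only [quaternion, sub_mulVec, smul_mulVec, one_mulVec, ← mulVec_mulVec, Pi.sub_apply,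
    Pi.smul_apply, onQubit_mulVec, rebitProduct, Fin.sum_univ_two]
  rcases hx with hx | hx <;> rcases hp with hp | hp <;>
    simp [hx, hp, hprod, rebit, sigmaJ, sigmaX, sigmaZ]

/-- Every rebit form and every real product of the other qubits is the image of `|0⋯0⟩` under
symmetries, so that Bob's state does not depend on it. -/
theorem bobReduced_ciphertext_rebitProduct (c : AlmostCommutingCircuit n) (α : Fin 2 → ℂ)
    (v : Fin n → Fin 2 → ℝ) (hα : ∑ i, ‖α i‖ ^ 2 = 1) (hv : ∀ k, k ≠ 0 → ∑ i, v k i ^ 2 = 1) :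
    bobReduced (ciphertext c (vecMulVec (rebitProduct α v) (star (rebitProduct α v)))) =
      bobReduced (ciphertext c (vecMulVec (rebitProduct ![1, 0] fun _ : Fin n => ![1, 0])
        (star (rebitProduct ![1, 0] fun _ : Fin n => ![1, 0])))) := by
  -- The other data qubits are rotated to `|0⟩` one at a time.
  have h1 (s : Finset (Fin n)) (hs : 0 ∉ s) :
      bobReduced (ciphertext c (vecMulVec (rebitProduct α v) (star (rebitProduct α v)))) =
      bobReduced (ciphertext c (vecMulVec (rebitProduct α (s.piecewise (fun _ => ![1, 0]) v))
        (star (rebitProduct α (s.piecewise (fun _ => ![1, 0]) v))))) := by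
    induction s using Finset.induction_on with
    | empty => simp
    | insert k s hk ih =>
      rw [Finset.mem_insert, not_or] at hs
      have hk0 : k ≠ 0 := Ne.symm hs.1
      rw [ih hs.2, Finset.piecewise_insert]
      have hn : v k 0 ^ 2 + v k 1 ^ 2 = 1 := by simpa using hv k hk0
      refine bobReduced_ciphertext_of_isSymmetry (isSymmetry_rotation hk0 hn) ?_
      rw [qData, onQubit_mulVec_initialVec]
      have := rotation_mulVec_rebitProduct hk0 α (s.piecewise (fun _ => ![1, 0]) v)
      rw [Finset.piecewise_eq_of_notMem _ _ _ hk] at this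
      rw [this]
  have h2 : rebitProduct α ((Finset.univ.erase (0 : Fin n)).piecewise (fun _ => ![1, 0]) v) =
      rebitProduct α fun _ : Fin n => ![1, 0] := by
    funext x
    simp only [rebitProduct]
    congr 1
    refine Finset.prod_congr rfl fun i hi => ?_
    rw [Finset.piecewise_eq_of_mem _ _ _ hi]
  rw [h1 (Finset.univ.erase 0) (by simp), h2]
  have hn : (α 0).re ^ 2 + (α 0).im ^ 2 + (α 1).re ^ 2 + (α 1).im ^ 2 = 1 := by
    simp only [Fin.sum_univ_two, ← Complex.normSq_eq_norm_sq, Complex.normSq_apply] at hα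
    linear_combination hα
  refine bobReduced_ciphertext_of_isSymmetry (isSymmetry_quaternion hn) ?_
  rw [← quaternion_mulVec_rebitProduct α]
  simp only [quaternion, sub_mulVec, smul_mulVec, one_mulVec, ← mulVec_mulVec, qData, qPhase,
    onQubit_mulVec_initialVec]
  funext x
  simp only [initialVec, Pi.sub_apply, Pi.smul_apply, sub_mul, smul_mul_assoc]

theorem realProduct_eq_rebitProduct (v : Fin n → Fin 2 → ℝ) :
    realProduct v = rebitProduct (fun i => (v 0 i : ℂ)) v := by
  funext x
  simp only [realProduct, rebitProduct, rebit,
    ← Finset.mul_prod_erase _ _ (Finset.mem_univ (0 : Fin n))]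
  split_ifs <;> simp

theorem bobReduced_ciphertext_of_mem_allowedInputs (c : AlmostCommutingCircuit n)
    {σ : Op (InputQubit n)} (hσ : σ ∈ allowedInputs n) :
    bobReduced (ciphertext c σ) =
      bobReduced (ciphertext c (vecMulVec (rebitProduct ![1, 0] fun _ : Fin n => ![1, 0])
        (star (rebitProduct ![1, 0] fun _ : Fin n => ![1, 0])))) := by
  refine convexHull_min (t := {σ | bobReduced (ciphertext c σ) = _}) ?_ ?_ hσ
  · rintro _ ⟨ψ, hψ, rfl⟩
    cases hψ with
    | real v hv =>
      rw [realProduct_eq_rebitProduct]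
      exact bobReduced_ciphertext_rebitProduct c _ v (by simpa using hv 0) fun k _ => hv k
    | complex α v hα hv => exact bobReduced_ciphertext_rebitProduct c α v hα hv
  · intro σ hσ σ' hσ' s t _ _ hst
    rw [Set.mem_ofPred_eq] at hσ hσ' ⊢
    rw [bobReduced_ciphertext_add_smul, hσ, hσ', ← add_smul, hst, one_smul]

end Inputs

end QHE

theorem theorem1 (n : ℕ) [NeZero n] (c : QHE.AlmostCommutingCircuit n)
    (σ σ' : QHE.Op (QHE.InputQubit n))
    (hσ : σ ∈ QHE.allowedInputs n) (hσ' : σ' ∈ QHE.allowedInputs n) :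
    QHE.bobReduced (QHE.ciphertext c σ) = QHE.bobReduced (QHE.ciphertext c σ') :=
  (QHE.bobReduced_ciphertext_of_mem_allowedInputs c hσ).trans
    (QHE.bobReduced_ciphertext_of_mem_allowedInputs c hσ').symm
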